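/- Theorem (Lower semi-continuity of the weighted path length). Let $n\in\mathbb{N}$, $\mathcal{C}=[-1,1]^n\subset\mathbb{R}^n$ (with the Euclidean norm $|\cdot|$), let $S\subset\mathcal{C}$ be Borel measurable and countably $1$-rectifiable, i.e. $S=\bigcup_{i=1}^\infty f_i(A_i)$ with $A_i\subset\mathbb{R}$ bounded and $f_i:A_i\to\mathbb{R}^n$ Lipschitz, let $a\in[0,\infty]$, and let $b:S\to[0,a]$ be lower semi-continuous. Assume that $$\mathcal{H}^1(\{z\in S\,:\,b(z)\le\lambda\})<\infty\qquad\text{for all }\lambda\in[0,a),$$ where $\mathcal{H}^1$ is the one-dimensional Hausdorff measure. Extend $b$ to $\mathbb{R}^n\setminus S$ by the value $a$, and for a Lipschitz path $\gamma:[0,1]\to\mathcal{C}$ set $$L(\gamma)=\int_{[0,1]}b(\gamma(t))\,|\dot\gamma(t)|\,\mathrm{d}t\in[0,\infty]\qquad(\text{with }\infty\cdot 0=0).$$ Let $C\ge0$ and let $\gamma_j:[0,1]\to\mathcal{C}$, $j\in\mathbb{N}$, be Lipschitz paths with Lipschitz constant at most $C$, each of constant speed (i.e. for every $j$ there is a constant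 $c_j$ with $|\dot\gamma_j|=c_j$ almost everywhere on $[0,1]$), such that $\gamma_j\to\gamma$ uniformly on $[0,1]$. Then $$L(\gamma)\le\liminf_{j\to\infty}L(\gamma_j).$$ (The uniform limit $\gamma$ is automatically a path in $\mathcal{C}$ with Lipschitz constant at most $C$.) -/

import Mathlib

open Set Filter MeasureTheory
open scoped ENNReal NNReal Topology

/-- The hypercube `[-1,1]^n` in Euclidean space. -/
def hypercube (n : ℕ) : Set (EuclideanSpace ℝ (Fin n)) :=
  {x | ∀ i, x i ∈ Icc (-1 : ℝ) 1}

/-- Countably `1`-rectifiable sets: countable unions of Lipschitz images of bounded subsets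
of the real line. -/
def CountablyOneRectifiable {n : ℕ} (S : Set (EuclideanSpace ℝ (Fin n))) : Prop :=
  ∃ (A : ℕ → Set ℝ) (f : ℕ → ℝ → EuclideanSpace ℝ (Fin n)),
    (∀ i, Bornology.IsBounded (A i)) ∧
    (∀ i, ∃ K : ℝ≥0, LipschitzOnWith K (f i) (A i)) ∧
    S = ⋃ i, f i '' A i

open Classical in
/-- The friction coefficient `b` on `S`, extended by the value `a` off `S`. The values of `b`
off `S` play no role. -/
noncomputable def frictionExt {n : ℕ} (S : Set (EuclideanSpace ℝ (Fin n))) (a : ℝ≥0∞)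
    (b : EuclideanSpace ℝ (Fin n) → ℝ≥0∞) (x : EuclideanSpace ℝ (Fin n)) : ℝ≥0∞ :=
  if x ∈ S then b x else a

/-- The part of the network with friction coefficient at most `lam`. -/
def sublevelNetwork {n : ℕ} (S : Set (EuclideanSpace ℝ (Fin n)))
    (b : EuclideanSpace ℝ (Fin n) → ℝ≥0∞) (lam : ℝ≥0) : Set (EuclideanSpace ℝ (Fin n)) :=
  {z | z ∈ S ∧ b z ≤ (lam : ℝ≥0∞)}

/-- Lipschitz paths `[0,1] → [-1,1]^n` with Lipschitz constant at most `C`. A path is given by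
a function on the whole line of which only the restriction to `[0,1]` matters. -/
def IsLipschitzPath {n : ℕ} (C : ℝ≥0) (γ : ℝ → EuclideanSpace ℝ (Fin n)) : Prop :=
  LipschitzOnWith C γ (Icc 0 1) ∧ MapsTo γ (Icc 0 1) (hypercube n)

/-- The path has constant speed: `|γ'|` is almost everywhere equal to a constant on `[0,1]`. -/
def HasConstantSpeed {n : ℕ} (γ : ℝ → EuclideanSpace ℝ (Fin n)) : Prop :=
  ∃ c : ℝ, ∀ᵐ t ∂(volume.restrict (Icc (0 : ℝ) 1)), ‖deriv γ t‖ = c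

/-- The weighted path length `L(γ) = ∫_{[0,1]} b(γ) |γ'|`, with `b = a` off `S` and the
convention `∞ * 0 = 0`. -/
noncomputable def weightedLength {n : ℕ} (S : Set (EuclideanSpace ℝ (Fin n))) (a : ℝ≥0∞)
    (b : EuclideanSpace ℝ (Fin n) → ℝ≥0∞) (γ : ℝ → EuclideanSpace ℝ (Fin n)) : ℝ≥0∞ :=
  ∫⁻ t in Icc (0 : ℝ) 1, frictionExt S a b (γ t) * ‖deriv γ t‖ₑ

/-! By the layer-cake formula, `L(γ)` is the integral over levels `l > 0` of the length that `γ`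
spends where the friction exceeds `l`. For `l ≥ a` that length is zero; for `l < a` it is the length
outside `E = {z ∈ S : b z ≤ l}`, a Borel set of finite `H¹`. Fatou's lemma in `l` reduces the claim
to lower semicontinuity of the length outside `E` (`lintegral_enorm_deriv_compl_le_liminf`).

There, a functional `p` of norm at most one turns length into measure on the line. Where `p ∘ γ` has
positive derivative, the intermediate value theorem makes `γ_j` attain the same `p`-value nearby for
large `j`. If `γ t ∉ E`, this happens off a closed `K ⊆ E` with `H¹(E \ K) < ε`, and the values
attained in `E \ K` have measure below `ε`. Hence the `p`-image is controlled by the liminf of the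
lengths outside `E` (`volume_image_le_liminf_lintegral`). Countably many functionals, on disjoint
pieces where `p ∘ γ` is injective, recover the speed up to `δ`; superadditivity of the liminf on
disjoint open sets sums the pieces (`sum_measure_le_of_superadditive`). -/

/-! ### Injective pieces, superadditive set functions and images on the line -/

/-- A set on which a real function has nonzero derivative is covered by countably many disjoint
measurable pieces on which the function is injective. -/
theorem exists_partition_injOn_of_hasDerivWithinAt (g : ℝ → ℝ) (s : Set ℝ) (g' : ℝ → ℝ)
    (hg : ∀ x ∈ s, HasDerivWithinAt g (g' x) s x) (hg' : ∀ x ∈ s, g' x ≠ 0) :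
    ∃ t : ℕ → Set ℝ, Pairwise (Function.onFun Disjoint t) ∧ (∀ k, MeasurableSet (t k)) ∧
      s ⊆ ⋃ k, t k ∧ ∀ k, InjOn g (s ∩ t k) := by
  classical
  obtain ⟨t, A, hd, hm, hc, happ, hA⟩ :=
    exists_partition_approximatesLinearOn_of_hasFDerivWithinAt g s
      (fun x => ContinuousLinearMap.toSpanSingleton ℝ (g' x))
      (fun x hx => (hg x hx).hasFDerivWithinAt)
      -- An error of half the slope forces `x = y` when `g x = g y`; the value `1` only keeps the
      -- tolerance nonzero.
      (fun A => if A 1 = 0 then 1 else ‖A 1‖₊ / 2)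
      (fun A => by split_ifs with h <;> simp [h])
  refine ⟨t, hd, hm, hc, fun k x hx y hy hxy => ?_⟩
  obtain ⟨z, hz, hAz⟩ := hA ⟨x, hx.1⟩ k
  have h1 : A k 1 ≠ 0 := by simpa [hAz] using hg' z hz
  have h := happ k x hx y hy
  have h2 : A k (x - y) = (x - y) * A k 1 := by
    simpa using (A k).map_smul (x - y) (1 : ℝ)
  simp only [hxy, sub_self, zero_sub, h1, if_false, h2, norm_neg, norm_mul, NNReal.coe_div,
    coe_nnnorm, NNReal.coe_ofNat] at h
  have h3 : 0 < ‖A k 1‖ := norm_pos_iff.2 h1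
  have h4 : ‖x - y‖ ≤ 0 := by nlinarith [norm_nonneg (x - y)]
  exact sub_eq_zero.1 (norm_le_zero_iff.1 h4)

/-- Inner regularity replaces the two carriers by disjoint compact sets, which have disjoint open
neighbourhoods on which superadditivity applies. -/
theorem measure_add_le_of_superadditive {ν : Set ℝ → ℝ≥0∞}
    (hmono : ∀ U W, U ⊆ W → ν U ≤ ν W)
    (hadd : ∀ U W, IsOpen U → IsOpen W → Disjoint U W → ν U + ν W ≤ ν (U ∪ W))
    {μ₁ μ₂ : Measure ℝ} [IsFiniteMeasure μ₁] [IsFiniteMeasure μ₂] {P₁ P₂ : Set ℝ}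
    (h₁m : MeasurableSet P₁) (h₂m : MeasurableSet P₂) (hd : Disjoint P₁ P₂)
    (h₁ : μ₁ P₁ᶜ = 0) (h₂ : μ₂ P₂ᶜ = 0)
    (h₁ν : ∀ U, IsOpen U → μ₁ U ≤ ν U) (h₂ν : ∀ U, IsOpen U → μ₂ U ≤ ν U)
    {U : Set ℝ} (hU : IsOpen U) : μ₁ U + μ₂ U ≤ ν U := by
  have key : ∀ {μ : Measure ℝ} [IsFiniteMeasure μ] {P : Set ℝ}, MeasurableSet P → μ Pᶜ = 0 →
      ∀ {ε : ℝ≥0∞}, ε ≠ 0 → ∃ K, K ⊆ P ∩ U ∧ IsCompact K ∧ μ U ≤ μ K + ε := by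
    intro μ _ P hP h0 ε hε
    obtain ⟨K, hK, hKc, hlt⟩ :=
      (hP.inter hU.measurableSet).exists_isCompact_lt_add (measure_ne_top μ _) hε
    refine ⟨K, hK, hKc, ?_⟩
    calc μ U ≤ μ (P ∩ U) + μ Pᶜ :=
          (measure_mono (fun x hx => by by_cases h : x ∈ P <;> simp [h, hx])).trans
            (measure_union_le _ _)
      _ ≤ μ K + ε := by rw [h0, add_zero]; exact hlt.le
  refine ENNReal.le_of_forall_pos_le_add fun ε hε _ => ?_
  have hε' : (ε / 2 : ℝ≥0∞) ≠ 0 := by simpa using hε.ne'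
  obtain ⟨K₁, hK₁, hc₁, hle₁⟩ := key h₁m h₁ hε'
  obtain ⟨K₂, hK₂, hc₂, hle₂⟩ := key h₂m h₂ hε'
  obtain ⟨W₁, W₂, ho₁, ho₂, hs₁, hs₂, hW⟩ := SeparatedNhds.of_isCompact_isCompact hc₁ hc₂
    (hd.mono (hK₁.trans inter_subset_left) (hK₂.trans inter_subset_left))
  have hb₁ : μ₁ K₁ ≤ ν (W₁ ∩ U) :=
    (measure_mono (subset_inter hs₁ (hK₁.trans inter_subset_right))).trans (h₁ν _ (ho₁.inter hU))
  have hb₂ : μ₂ K₂ ≤ ν (W₂ ∩ U) :=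
    (measure_mono (subset_inter hs₂ (hK₂.trans inter_subset_right))).trans (h₂ν _ (ho₂.inter hU))
  calc μ₁ U + μ₂ U ≤ (ν (W₁ ∩ U) + ε / 2) + (ν (W₂ ∩ U) + ε / 2) := by
        gcongr
        · exact hle₁.trans (by gcongr)
        · exact hle₂.trans (by gcongr)
    _ = (ν (W₁ ∩ U) + ν (W₂ ∩ U)) + (ε / 2 + ε / 2) := by ring
    _ ≤ ν U + ε := by
        rw [ENNReal.add_halves]
        gcongr
        exact (hadd _ _ (ho₁.inter hU) (ho₂.inter hU)
          (hW.mono inter_subset_left inter_subset_left)).trans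
          (hmono _ _ (union_subset inter_subset_right inter_subset_right))

/-- A monotone set function that is superadditive on disjoint open sets and dominates, on open
sets, each of a family of mutually singular finite measures also dominates their sum. -/
theorem sum_measure_le_of_superadditive {ι : Type*} {ν : Set ℝ → ℝ≥0∞}
    (hmono : ∀ U W, U ⊆ W → ν U ≤ ν W)
    (hadd : ∀ U W, IsOpen U → IsOpen W → Disjoint U W → ν U + ν W ≤ ν (U ∪ W))
    {μ : ι → Measure ℝ} [∀ i, IsFiniteMeasure (μ i)] {P : ι → Set ℝ}
    (hPm : ∀ i, MeasurableSet (P i)) (hPd : Pairwise (Function.onFun Disjoint P))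
    (hP : ∀ i, μ i (P i)ᶜ = 0) (hν : ∀ i U, IsOpen U → μ i U ≤ ν U) (I : Finset ι) :
    ∀ U, IsOpen U → ∑ i ∈ I, μ i U ≤ ν U := by
  classical
  induction I using Finset.induction_on with
  | empty => simp
  | insert i I hi ih =>
    intro U hU
    rw [Finset.sum_insert hi]
    have hsum : ∀ W, (∑ k ∈ I, μ k) W = ∑ k ∈ I, μ k W := fun W => by simp
    rw [← hsum]
    refine measure_add_le_of_superadditive hmono hadd (hPm i)
      (P₂ := ⋃ k ∈ I, P k) (I.measurableSet_biUnion fun k _ => hPm k) ?_ (hP i) ?_ (hν i) ?_ hU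
    · rw [disjoint_iUnion₂_right]
      exact fun k hk => hPd (ne_of_mem_of_not_mem hk hi).symm
    · rw [hsum]
      refine Finset.sum_eq_zero fun k hk => measure_mono_null ?_ (hP k)
      exact compl_subset_compl.2 (subset_biUnion_of_mem (u := P) hk)
    · intro W hW
      rw [hsum]
      exact ih W hW

theorem volume_image_le_lintegral_enorm_deriv {g : ℝ → ℝ} {C : ℝ≥0} (hg : LipschitzWith C g)
    {A : Set ℝ} (hA : MeasurableSet A) : volume (g '' A) ≤ ∫⁻ t in A, ‖deriv g t‖ₑ := by
  set D := {t | DifferentiableAt ℝ g t}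
  have hD : MeasurableSet D := measurableSet_of_differentiableAt ℝ g
  have h0 : volume (g '' (A \ D)) = 0 := by
    have h1 : volume (A \ D) = 0 :=
      measure_mono_null (fun t ht => ht.2) (hg.ae_differentiableAt (μ := volume))
    rw [← hausdorffMeasure_real] at h1 ⊢
    have := hg.hausdorffMeasure_image_le zero_le_one (A \ D)
    rw [h1, mul_zero] at this
    exact le_antisymm this zero_le
  calc volume (g '' A) ≤ volume (g '' (A ∩ D)) + volume (g '' (A \ D)) := by
        refine (measure_mono ?_).trans (measure_union_le _ _)
        rw [← image_union, inter_union_sdiff]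
    _ ≤ ∫⁻ t in A ∩ D, ‖deriv g t‖ₑ := by
        rw [h0, add_zero]
        refine (addHaar_image_le_lintegral_abs_det_fderiv volume (hA.inter hD)
          (fun t ht => (ht.2.hasDerivAt.hasFDerivAt).hasFDerivWithinAt)).trans_eq ?_
        simp [Real.enorm_eq_ofReal_abs]
    _ ≤ _ := lintegral_mono_set inter_subset_left

theorem volume_liminf_le {A : ℕ → Set ℝ} {B : Set ℝ} (h : ∀ x ∈ B, ∀ᶠ j in atTop, x ∈ A j) :
    volume B ≤ liminf (fun j => volume (A j)) atTop := by
  have hsub : B ⊆ ⋃ m, ⋂ j ≥ m, A j := fun x hx => by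
    simpa using eventually_atTop.1 (h x hx)
  refine (measure_mono hsub).trans ?_
  rw [Monotone.measure_iUnion, liminf_eq_iSup_iInf_of_nat]
  · exact iSup_mono fun m => le_iInf₂ fun j hj => measure_mono (biInter_subset_of_mem hj)
  · exact fun m k hmk => biInter_subset_biInter_left fun j hj => hmk.trans hj

/-! ### Projected images of paths outside a set of finite `H¹` -/

section PathsAvoidingSet

variable {X : Type*} [NormedAddCommGroup X] [NormedSpace ℝ X]

theorem volume_image_le_hausdorffMeasure [MeasurableSpace X] [BorelSpace X]
    {p : X →L[ℝ] ℝ} (hp : ‖p‖ ≤ 1) (A : Set X) :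
    volume (p '' A) ≤ (Measure.hausdorffMeasure 1 : Measure X) A := by
  have h : LipschitzWith 1 p := p.lipschitz.weaken (by exact_mod_cast hp)
  simpa [← hausdorffMeasure_real] using h.hausdorffMeasure_image_le zero_le_one A

/-- Near a point where `p ∘ γ` has positive derivative, every uniformly close continuous path
takes the same `p`-value, and stays in a given neighbourhood of the limit point. -/
theorem eventually_mem_image_of_deriv_pos {γ : ℕ → ℝ → X} {γlim : ℝ → X}
    (hγ : ∀ j, Continuous (γ j)) (hlimc : Continuous γlim)
    (hlim : TendstoUniformly γ γlim atTop) {p : X →L[ℝ] ℝ} {U : Set ℝ} (hU : IsOpen U)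
    {O : Set X} (hO : IsOpen O) {t : ℝ} (htU : t ∈ U) (htO : γlim t ∈ O) {d : ℝ} (hd : 0 < d)
    (hderiv : HasDerivAt (fun s => p (γlim s)) d t) :
    ∀ᶠ j in atTop, p (γlim t) ∈ (fun s => p (γ j s)) '' (U ∩ γ j ⁻¹' O) := by
  obtain ⟨r, hr, hball⟩ := Metric.isOpen_iff.1 hO _ htO
  -- Half of `r` is for the variation of `γlim` near `t`, half for the uniform distance to `γ j`.
  have hnear : ∀ᶠ s in 𝓝 t, s ∈ U ∧ dist (γlim s) (γlim t) < r / 2 :=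
    Eventually.and (hU.mem_nhds htU) (hlimc.continuousAt (Metric.ball_mem_nhds _ (half_pos hr)))
  obtain ⟨δ, hδ, hδball⟩ := Metric.eventually_nhds_iff_ball.1 hnear
  have hslope : ∀ᶠ s in 𝓝[≠] t, 0 < slope (fun s => p (γlim s)) t s :=
    (hasDerivAt_iff_tendsto_slope.1 hderiv).eventually (lt_mem_nhds hd)
  have hright : ∃ s, t < s ∧ s < t + δ ∧ p (γlim t) < p (γlim s) := by
    have h : ∀ᶠ s in 𝓝[>] t, 0 < slope (fun s => p (γlim s)) t s :=
      hslope.filter_mono (nhdsWithin_mono _ fun s (hs : t < s) => hs.ne')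
    obtain ⟨s, hs, hs'⟩ := (h.and (Ioo_mem_nhdsGT (lt_add_of_pos_right t hδ))).exists
    refine ⟨s, hs'.1, hs'.2, ?_⟩
    rw [slope_def_field] at hs
    exact sub_pos.1 ((div_pos_iff_of_pos_right (sub_pos.2 hs'.1)).1 hs)
  have hleft : ∃ s, t - δ < s ∧ s < t ∧ p (γlim s) < p (γlim t) := by
    have h : ∀ᶠ s in 𝓝[<] t, 0 < slope (fun s => p (γlim s)) t s :=
      hslope.filter_mono (nhdsWithin_mono _ fun s (hs : s < t) => hs.ne)
    obtain ⟨s, hs, hs'⟩ := (h.and (Ioo_mem_nhdsLT (sub_lt_self t hδ))).exists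
    refine ⟨s, hs'.1, hs'.2, ?_⟩
    rw [slope_def_field, ← neg_div_neg_eq, neg_sub, neg_sub] at hs
    exact sub_pos.1 ((div_pos_iff_of_pos_right (sub_pos.2 hs'.2)).1 hs)
  obtain ⟨s₂, hts₂, hs₂δ, hs₂⟩ := hright
  obtain ⟨s₁, hs₁δ, hs₁t, hs₁⟩ := hleft
  have hpt : ∀ s, Tendsto (fun j => p (γ j s)) atTop (𝓝 (p (γlim s))) := fun s =>
    (p.continuous.tendsto _).comp (hlim.tendsto_at s)
  filter_upwards [(hpt s₁).eventually (gt_mem_nhds hs₁), (hpt s₂).eventually (lt_mem_nhds hs₂),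
    Metric.tendstoUniformly_iff.1 hlim (r / 2) (half_pos hr)] with j h₁ h₂ hj
  obtain ⟨s, hs, hps⟩ := intermediate_value_Icc (hs₁t.trans hts₂).le
    (p.continuous.comp (hγ j)).continuousOn ⟨h₁.le, h₂.le⟩
  have hsb : s ∈ Metric.ball t δ := by
    rw [Real.ball_eq_Ioo]
    exact ⟨hs₁δ.trans_le hs.1, hs.2.trans_lt hs₂δ⟩
  obtain ⟨hsU, hsr⟩ := hδball s hsb
  refine ⟨s, ⟨hsU, hball ?_⟩, hps⟩
  have := dist_triangle_left (γ j s) (γlim t) (γlim s)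
  rw [Metric.mem_ball]
  linarith [hj s]

variable [FiniteDimensional ℝ X]

theorem volume_image_comp_le_lintegral_enorm_deriv {γ : ℝ → X} {C : ℝ≥0}
    (hγ : LipschitzWith C γ) {p : X →L[ℝ] ℝ} (hp : ‖p‖ ≤ 1) {A : Set ℝ} (hA : MeasurableSet A) :
    volume ((fun t => p (γ t)) '' A) ≤ ∫⁻ t in A, ‖deriv γ t‖ₑ := by
  refine (volume_image_le_lintegral_enorm_deriv (p.lipschitz.comp hγ) hA).trans ?_
  refine lintegral_mono_ae (ae_restrict_of_ae ?_)
  filter_upwards [hγ.ae_differentiableAt (μ := volume)] with t ht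
  have h : HasDerivAt (p ∘ γ) (p (deriv γ t)) t := p.hasFDerivAt.comp_hasDerivAt t ht.hasDerivAt
  rw [h.deriv, ← ofReal_norm, ← ofReal_norm]
  exact ENNReal.ofReal_le_ofReal (by simpa using p.le_of_opNorm_le hp (deriv γ t))

theorem volume_image_le_liminf_lintegral [MeasurableSpace X] [BorelSpace X] {C : ℝ≥0}
    {γ : ℕ → ℝ → X} {γlim : ℝ → X}
    (hγ : ∀ j, LipschitzWith C (γ j)) (hlimc : Continuous γlim)
    (hlim : TendstoUniformly γ γlim atTop) {E : Set X} (hE : MeasurableSet E)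
    (hEfin : (Measure.hausdorffMeasure 1 : Measure X) E < ∞)
    {p : X →L[ℝ] ℝ} (hp : ‖p‖ ≤ 1) {U : Set ℝ} (hU : IsOpen U) {B : Set ℝ} (hBU : B ⊆ U)
    (hBE : ∀ t ∈ B, γlim t ∉ E)
    (hB : ∀ t ∈ B, ∃ d > 0, HasDerivAt (fun s => p (γlim s)) d t) :
    volume ((fun s => p (γlim s)) '' B) ≤
      liminf (fun j => ∫⁻ t in U ∩ γ j ⁻¹' Eᶜ, ‖deriv (γ j) t‖ₑ) atTop := by
  refine ENNReal.le_of_forall_pos_le_add fun ε hε _ => ?_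
  set H : Measure X := (Measure.hausdorffMeasure 1 : Measure X).restrict E
  have : IsFiniteMeasure H := isFiniteMeasure_restrict.2 hEfin.ne
  -- `E` need not be closed, so its complement is replaced by the open set `Kᶜ`, at cost `ε`.
  obtain ⟨K, hKE, hKc, hKlt⟩ := hE.exists_isClosed_sdiff_lt (μ := H) (measure_ne_top _ _)
    (ENNReal.coe_ne_zero.2 hε.ne')
  rw [Measure.restrict_apply' hE, inter_eq_left.2 sdiff_subset] at hKlt
  calc volume ((fun s => p (γlim s)) '' B)
      ≤ liminf (fun j => volume ((fun s => p (γ j s)) '' (U ∩ γ j ⁻¹' Kᶜ))) atTop := by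
        refine volume_liminf_le ?_
        rintro _ ⟨t, ht, rfl⟩
        obtain ⟨d, hd, hderiv⟩ := hB t ht
        exact eventually_mem_image_of_deriv_pos (fun j => (hγ j).continuous) hlimc hlim hU
          hKc.isOpen_compl (hBU ht) (fun h => hBE t ht (hKE h)) hd hderiv
    _ ≤ liminf (fun j => (∫⁻ t in U ∩ γ j ⁻¹' Eᶜ, ‖deriv (γ j) t‖ₑ) + ε) atTop := by
        refine liminf_le_liminf (Eventually.of_forall fun j => ?_)
        have hsub : (fun s => p (γ j s)) '' (U ∩ γ j ⁻¹' Kᶜ) ⊆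
            (fun s => p (γ j s)) '' (U ∩ γ j ⁻¹' Eᶜ) ∪ p '' (E \ K) := by
          rintro _ ⟨s, ⟨hsU, hsK⟩, rfl⟩
          by_cases hs : γ j s ∈ E
          · exact Or.inr ⟨_, ⟨hs, hsK⟩, rfl⟩
          · exact Or.inl ⟨s, ⟨hsU, hs⟩, rfl⟩
        refine (measure_mono hsub).trans ((measure_union_le _ _).trans ?_)
        gcongr
        · exact volume_image_comp_le_lintegral_enorm_deriv (hγ j) hp
            (hU.measurableSet.inter ((hγ j).continuous.measurable hE.compl))
        · exact (volume_image_le_hausdorffMeasure hp _).trans hKlt.le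
    _ = _ := liminf_add_const atTop _ _ (by isBoundedDefault) (by isBoundedDefault)

end PathsAvoidingSet

theorem ENNReal.liminf_add_liminf_le (u v : ℕ → ℝ≥0∞) :
    liminf u atTop + liminf v atTop ≤ liminf (fun j => u j + v j) atTop := by
  rw [liminf_eq_iSup_iInf_of_nat (u := u), liminf_eq_iSup_iInf_of_nat (u := v)]
  refine ENNReal.iSup_add_iSup_le fun i k => le_liminf_of_le (by isBoundedDefault) ?_
  filter_upwards [eventually_ge_atTop i, eventually_ge_atTop k] with j hi hk
  exact add_le_add (iInf₂_le j hi) (iInf₂_le j hk)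

/-! ### Lower semicontinuity of the length outside `E` -/

section LengthOutside

variable {X : Type*} [NormedAddCommGroup X] [NormedSpace ℝ X] [FiniteDimensional ℝ X]
  [MeasurableSpace X] [BorelSpace X]

/-- The derivative of a path is, up to a small additive error, captured by countably many
functionals of norm at most one on disjoint measurable sets. -/
theorem exists_partition_norm_deriv_le (γ : ℝ → X) {δ : ℝ} (hδ : 0 < δ) :
    ∃ (p : ℕ → X →L[ℝ] ℝ) (D : ℕ → Set ℝ), (∀ m, ‖p m‖ ≤ 1) ∧ (∀ m, MeasurableSet (D m)) ∧
      Pairwise (Function.onFun Disjoint D) ∧ (⋃ m, D m) = univ ∧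
      ∀ m, ∀ t ∈ D m, ‖deriv γ t‖ ≤ p m (deriv γ t) + δ := by
  choose p hp hpv using fun m => exists_dual_vector'' ℝ (TopologicalSpace.denseSeq X m)
  set D₀ : ℕ → Set ℝ := fun m => {t | dist (deriv γ t) (TopologicalSpace.denseSeq X m) < δ / 2}
  have hD₀ : ∀ m, MeasurableSet (D₀ m) := fun m =>
    measurableSet_lt ((measurable_deriv γ).dist measurable_const) measurable_const
  refine ⟨p, disjointed D₀, hp, MeasurableSet.disjointed hD₀, disjoint_disjointed D₀, ?_, ?_⟩
  · rw [iUnion_disjointed, eq_univ_iff_forall]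
    intro t
    obtain ⟨m, hm⟩ := (TopologicalSpace.denseRange_denseSeq X).exists_dist_lt (deriv γ t)
      (half_pos hδ)
    exact mem_iUnion.2 ⟨m, hm⟩
  · intro m t ht
    have ht' : ‖deriv γ t - TopologicalSpace.denseSeq X m‖ < δ / 2 := by
      simpa [D₀, dist_eq_norm] using disjointed_subset D₀ m ht
    set v := TopologicalSpace.denseSeq X m
    have h1 : ‖deriv γ t‖ ≤ ‖deriv γ t - v‖ + ‖v‖ := by
      simpa using norm_add_le (deriv γ t - v) v
    have h2 : ‖v‖ = p m v := by simpa using (hpv m).symm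
    have h3 : p m v - p m (deriv γ t) ≤ ‖deriv γ t - v‖ := by
      rw [← map_sub, norm_sub_rev]
      exact (le_abs_self _).trans (by simpa using (p m).le_of_opNorm_le (hp m) (v - deriv γ t))
    linarith

/-- Lower semicontinuity, under uniform convergence of equi-Lipschitz paths, of the length spent
outside a Borel set of finite one-dimensional Hausdorff measure. -/
theorem lintegral_enorm_deriv_compl_le_liminf {C : ℝ≥0} {γ : ℕ → ℝ → X} {γlim : ℝ → X}
    (hγ : ∀ j, LipschitzWith C (γ j)) (hlimL : LipschitzWith C γlim)
    (hlim : TendstoUniformly γ γlim atTop) {E : Set X} (hE : MeasurableSet E)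
    (hEfin : (Measure.hausdorffMeasure 1 : Measure X) E < ∞)
    {V : Set ℝ} (hV : IsOpen V) (hVfin : volume V ≠ ∞) :
    ∫⁻ t in V ∩ γlim ⁻¹' Eᶜ, ‖deriv γlim t‖ₑ ≤
      liminf (fun j => ∫⁻ t in V ∩ γ j ⁻¹' Eᶜ, ‖deriv (γ j) t‖ₑ) atTop := by
  set ν : Set ℝ → ℝ≥0∞ := fun U =>
    liminf (fun j => ∫⁻ t in U ∩ γ j ⁻¹' Eᶜ, ‖deriv (γ j) t‖ₑ) atTop
  have hmeas : ∀ j, MeasurableSet (γ j ⁻¹' Eᶜ) := fun j =>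
    (hγ j).continuous.measurable hE.compl
  have hmono : ∀ U W, U ⊆ W → ν U ≤ ν W := fun U W hUW =>
    liminf_le_liminf (Eventually.of_forall fun j =>
      lintegral_mono_set (inter_subset_inter_left _ hUW))
  have hadd : ∀ U W, IsOpen U → IsOpen W → Disjoint U W → ν U + ν W ≤ ν (U ∪ W) := by
    intro U W hU hW hUW
    refine (ENNReal.liminf_add_liminf_le _ _).trans
      (liminf_le_liminf (Eventually.of_forall fun j => ?_))
    rw [union_inter_distrib_right, lintegral_union (hW.measurableSet.inter (hmeas j))
      (hUW.mono inter_subset_left inter_subset_left)]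
  have happrox : ∀ δ : ℝ≥0, 0 < δ →
      ∫⁻ t in V ∩ γlim ⁻¹' Eᶜ, ‖deriv γlim t‖ₑ ≤ ν V + δ * volume V := by
    intro δ hδ
    obtain ⟨p, D, hp, hDm, hDd, hDu, hD⟩ :=
      exists_partition_norm_deriv_le γlim (δ := δ) (by exact_mod_cast hδ)
    set F : Set ℝ := V ∩ γlim ⁻¹' Eᶜ ∩ {t | DifferentiableAt ℝ γlim t}
    have hFm : MeasurableSet F :=
      (hV.measurableSet.inter (hlimL.continuous.measurable hE.compl)).inter
        (measurableSet_of_differentiableAt ℝ γlim)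
    have hFV : F ⊆ V := fun t ht => ht.1.1
    have hpm : ∀ m, Measurable fun t => p m (deriv γlim t) := fun m =>
      (p m).continuous.measurable.comp (measurable_deriv γlim)
    -- Positivity gives both the injective pieces and the upward crossing; where it fails,
    -- `ENNReal.ofReal` vanishes.
    set S : ℕ → Set ℝ := fun m => F ∩ D m ∩ {t | 0 < p m (deriv γlim t)}
    have hSm : ∀ m, MeasurableSet (S m) := fun m =>
      (hFm.inter (hDm m)).inter (measurableSet_lt measurable_const (hpm m))
    have hder : ∀ m, ∀ t ∈ F, HasDerivAt (fun s => p m (γlim s)) (p m (deriv γlim t)) t :=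
      fun m t ht => (p m).hasFDerivAt.comp_hasDerivAt t ht.2.hasDerivAt
    choose T hTd hTm hTc hTi using fun m => exists_partition_injOn_of_hasDerivWithinAt
      (fun s => p m (γlim s)) (S m) (fun t => p m (deriv γlim t))
      (fun t ht => (hder m t ht.1.1).hasDerivWithinAt) (fun t ht => ht.2.ne')
    set P : ℕ × ℕ → Set ℝ := fun i => S i.1 ∩ T i.1 i.2
    have hPm : ∀ i, MeasurableSet (P i) := fun i => (hSm i.1).inter (hTm i.1 i.2)
    have hPd : Pairwise (Function.onFun Disjoint P) := by
      rintro ⟨m, k⟩ ⟨m', k'⟩ hne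
      by_cases h : m = m'
      · subst h
        exact (hTd m fun h : k = k' => hne (by rw [h])).mono inter_subset_right inter_subset_right
      · exact (hDd h).mono (fun t ht => ht.1.1.2) (fun t ht => ht.1.1.2)
    have hPV : ∀ i, P i ⊆ V := fun i t ht => hFV ht.1.1.1
    set μ : ℕ × ℕ → Measure ℝ := fun i =>
      (volume.restrict (P i)).withDensity fun t => ENNReal.ofReal (p i.1 (deriv γlim t))
    have hμ : ∀ i U, IsOpen U →
        μ i U = ∫⁻ t in U ∩ P i, ENNReal.ofReal (p i.1 (deriv γlim t)) := fun i U hU => by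
      rw [withDensity_apply _ hU.measurableSet, Measure.restrict_restrict hU.measurableSet]
    have hfinite : ∀ i, IsFiniteMeasure (μ i) := fun i => by
      refine isFiniteMeasure_withDensity (ne_top_of_le_ne_top
        (ENNReal.mul_ne_top (ENNReal.coe_ne_top (r := C)) hVfin) ?_)
      calc ∫⁻ t in P i, ENNReal.ofReal (p i.1 (deriv γlim t)) ≤ ∫⁻ _ in P i, (C : ℝ≥0∞) := by
            refine lintegral_mono fun t => ?_
            rw [← ENNReal.ofReal_coe_nnreal]
            refine ENNReal.ofReal_le_ofReal ((le_abs_self _).trans ?_)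
            refine ((p i.1).le_of_opNorm_le (hp i.1) _).trans ?_
            rw [one_mul]
            exact norm_deriv_le_of_lipschitz hlimL
        _ ≤ C * volume V := by
            rw [setLIntegral_const]
            gcongr
            exact hPV i
    have hμ0 : ∀ i, μ i (P i)ᶜ = 0 := fun i => by
      rw [withDensity_apply _ (hPm i).compl, Measure.restrict_restrict (hPm i).compl]
      simp
    have hμν : ∀ i U, IsOpen U → μ i U ≤ ν U := by
      intro i U hU
      -- By injectivity, the area formula makes the integral of the projected speed equal to the
      -- measure of the image.
      have himage := lintegral_image_eq_lintegral_abs_deriv_mul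
        (hU.measurableSet.inter (hPm i)) (f := fun s => p i.1 (γlim s))
        (fun t ht => (hder i.1 t ht.2.1.1.1).hasDerivWithinAt)
        ((hTi i.1 i.2).mono inter_subset_right) 1
      simp only [Pi.one_apply, mul_one, setLIntegral_one] at himage
      rw [hμ i U hU]
      calc ∫⁻ t in U ∩ P i, ENNReal.ofReal (p i.1 (deriv γlim t))
          ≤ ∫⁻ t in U ∩ P i, ENNReal.ofReal |p i.1 (deriv γlim t)| :=
            lintegral_mono fun t => ENNReal.ofReal_le_ofReal (le_abs_self _)
        _ ≤ ν U := by
            rw [← himage]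
            exact volume_image_le_liminf_lintegral hγ hlimL.continuous hlim hE hEfin (hp i.1) hU
              inter_subset_left (fun t ht => ht.2.1.1.1.1.2)
              (fun t ht => ⟨_, ht.2.1.2, hder i.1 t ht.2.1.1.1⟩)
    have hsum : ∑' i, μ i V ≤ ν V :=
      ENNReal.summable.tsum_le_of_sum_le fun I =>
        sum_measure_le_of_superadditive hmono hadd hPm hPd hμ0 hμν I V hV
    have hpiece : ∀ m, ∫⁻ t in F ∩ D m, ‖deriv γlim t‖ₑ ≤
        (∑' k, μ (m, k) V) + δ * volume (F ∩ D m) := by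
      intro m
      calc ∫⁻ t in F ∩ D m, ‖deriv γlim t‖ₑ
          ≤ ∫⁻ t in F ∩ D m, (ENNReal.ofReal (p m (deriv γlim t)) + δ) := by
            refine setLIntegral_mono' (hFm.inter (hDm m)) fun t ht => ?_
            rw [← ofReal_norm, ← ENNReal.ofReal_coe_nnreal]
            exact (ENNReal.ofReal_le_ofReal (hD m t ht.2)).trans ENNReal.ofReal_add_le
        _ = (∫⁻ t in F ∩ D m, ENNReal.ofReal (p m (deriv γlim t))) + δ * volume (F ∩ D m) := by
            rw [lintegral_add_right _ measurable_const, setLIntegral_const]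
        _ ≤ _ := by
            gcongr
            calc ∫⁻ t in F ∩ D m, ENNReal.ofReal (p m (deriv γlim t))
                ≤ ∫⁻ t in S m, ENNReal.ofReal (p m (deriv γlim t)) := by
                  rw [← lintegral_inter_add_sdiff _ (F ∩ D m)
                    (measurableSet_lt measurable_const (hpm m))]
                  refine (add_le_of_nonpos_right (le_of_eq ?_))
                  refine (setLIntegral_congr_fun ((hFm.inter (hDm m)).diff
                    (measurableSet_lt measurable_const (hpm m))) (g := 0) fun t ht => ?_).trans
                    (by simp)
                  exact ENNReal.ofReal_of_nonpos (not_lt.1 ht.2)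
              _ ≤ ∫⁻ t in ⋃ k, P (m, k), ENNReal.ofReal (p m (deriv γlim t)) :=
                  lintegral_mono_set fun t ht => by
                    obtain ⟨k, hk⟩ := mem_iUnion.1 (hTc m ht)
                    exact mem_iUnion.2 ⟨k, ht, hk⟩
              _ ≤ ∑' k, ∫⁻ t in P (m, k), ENNReal.ofReal (p m (deriv γlim t)) :=
                  lintegral_iUnion_le _ _
              _ = ∑' k, μ (m, k) V := by
                  refine tsum_congr fun k => ?_
                  rw [hμ _ V hV, inter_eq_right.2 (hPV (m, k))]
    calc ∫⁻ t in V ∩ γlim ⁻¹' Eᶜ, ‖deriv γlim t‖ₑ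
        ≤ ∫⁻ t in F, ‖deriv γlim t‖ₑ := by
          refine lintegral_mono' (Measure.restrict_mono_ae ?_) le_rfl
          filter_upwards [hlimL.ae_differentiableAt (μ := volume)] with t ht h
          exact ⟨h, ht⟩
      _ ≤ ∫⁻ t in ⋃ m, F ∩ D m, ‖deriv γlim t‖ₑ := by
          rw [← inter_iUnion, hDu, inter_univ]
      _ ≤ ∑' m, ∫⁻ t in F ∩ D m, ‖deriv γlim t‖ₑ := lintegral_iUnion_le _ _
      _ ≤ ∑' m, ((∑' k, μ (m, k) V) + δ * volume (F ∩ D m)) := ENNReal.tsum_le_tsum hpiece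
      _ = (∑' i, μ i V) + δ * volume F := by
          rw [ENNReal.tsum_add, ENNReal.tsum_prod', ENNReal.tsum_mul_left, ← measure_iUnion
            (fun m m' h => (hDd h).mono inter_subset_right inter_subset_right)
            (fun m => hFm.inter (hDm m)), ← inter_iUnion, hDu, inter_univ]
      _ ≤ ν V + δ * volume V := by gcongr
  have htend : Tendsto (fun δ : ℝ≥0 => ν V + δ * volume V) (𝓝[>] 0)
      (𝓝 (ν V + ((0 : ℝ≥0) : ℝ≥0∞) * volume V)) := by
    refine (tendsto_const_nhds.add ?_).mono_left nhdsWithin_le_nhds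
    exact ENNReal.Tendsto.mul_const (ENNReal.tendsto_coe.2 tendsto_id) (Or.inr hVfin)
  rw [ENNReal.coe_zero, zero_mul, add_zero] at htend
  exact ge_of_tendsto htend (eventually_nhdsWithin_of_forall happrox)

end LengthOutside

/-! ### Layer-cake formula -/

theorem volume_Ioi_inter_ofReal_lt (x : ℝ≥0∞) :
    volume (Ioi (0 : ℝ) ∩ {l | ENNReal.ofReal l < x}) = x := by
  induction x with
  | top => simp
  | coe r =>
    have h : Ioi (0 : ℝ) ∩ {l | ENNReal.ofReal l < r} = Ioo 0 (r : ℝ) := by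
      ext l
      simp only [mem_inter_iff, mem_Ioi, mem_ofPred_eq, mem_Ioo, and_congr_right_iff]
      intro hl
      rw [← ENNReal.ofReal_coe_nnreal, ENNReal.ofReal_lt_ofReal_iff_of_nonneg hl.le]
    rw [h, Real.volume_Ioo, sub_zero, ENNReal.ofReal_coe_nnreal]

/-- Layer-cake formula for a weight that may take the value `∞`. -/
theorem lintegral_mul_eq_lintegral_superlevel {h w : ℝ → ℝ≥0∞} (hh : Measurable h)
    (hw : Measurable w) (V : Set ℝ) :
    ∫⁻ t in V, h t * w t =
      ∫⁻ l in Ioi (0 : ℝ), ∫⁻ t in V ∩ {t | ENNReal.ofReal l < h t}, w t := by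
  have hset : MeasurableSet {q : ℝ × ℝ | ENNReal.ofReal q.1 < h q.2} :=
    measurableSet_lt (ENNReal.measurable_ofReal.comp measurable_fst) (hh.comp measurable_snd)
  have hsec : ∀ l : ℝ, MeasurableSet {t | ENNReal.ofReal l < h t} := fun l =>
    measurableSet_lt measurable_const hh
  have hsec' : ∀ t : ℝ, MeasurableSet {l : ℝ | ENNReal.ofReal l < h t} := fun t =>
    measurableSet_lt ENNReal.measurable_ofReal measurable_const
  set f : ℝ → ℝ → ℝ≥0∞ := fun l t => {q : ℝ × ℝ | ENNReal.ofReal q.1 < h q.2}.indicator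
    (fun q => w q.2) (l, t)
  have hf : Measurable (Function.uncurry f) := (hw.comp measurable_snd).indicator hset
  have h1 : ∀ l, ∫⁻ t in V ∩ {t | ENNReal.ofReal l < h t}, w t = ∫⁻ t in V, f l t := by
    intro l
    rw [inter_comm, ← Measure.restrict_restrict (hsec l), ← lintegral_indicator (hsec l)]
    rfl
  have h2 : ∀ t, ∫⁻ l in Ioi (0 : ℝ), f l t = h t * w t := by
    intro t
    have : (fun l => f l t) = {l : ℝ | ENNReal.ofReal l < h t}.indicator fun _ => w t := rfl
    rw [this, lintegral_indicator (hsec' t), Measure.restrict_restrict (hsec' t),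
      setLIntegral_const, inter_comm, volume_Ioi_inter_ofReal_lt, mul_comm]
  simp_rw [h1]
  rw [lintegral_lintegral_swap hf.aemeasurable]
  simp_rw [h2]

/-! ### Sublevel sets of the friction and Fatou's lemma in the level -/

section Network

variable {n : ℕ} {S : Set (EuclideanSpace ℝ (Fin n))} {a : ℝ≥0∞}
  {b : EuclideanSpace ℝ (Fin n) → ℝ≥0∞}

theorem measurableSet_sublevelNetwork (hS : MeasurableSet S) (hb : LowerSemicontinuousOn b S)
    (lam : ℝ≥0) : MeasurableSet (sublevelNetwork S b lam) := by
  obtain ⟨u, hu, hSu⟩ := lowerSemicontinuousOn_iff_preimage_Ioi.1 hb lam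
  have h : sublevelNetwork S b lam = S \ (S ∩ u) := by
    rw [← hSu]
    ext z
    simp only [sublevelNetwork, mem_ofPred_eq, Set.mem_sdiff, mem_inter_iff, mem_preimage, mem_Ioi]
    grind
  rw [h]
  exact hS.diff (hS.inter hu.measurableSet)

theorem measurable_frictionExt (hS : MeasurableSet S) (hb : LowerSemicontinuousOn b S) :
    Measurable (frictionExt S a b) := by
  refine measurable_of_Ioi fun x => ?_
  obtain ⟨u, hu, hSu⟩ := lowerSemicontinuousOn_iff_preimage_Ioi.1 hb x
  have h : frictionExt S a b ⁻¹' Ioi x = (S ∩ u) ∪ (Sᶜ ∩ {_z | x < a}) := by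
    rw [← hSu]
    ext z
    by_cases hz : z ∈ S <;> simp [frictionExt, hz]
  rw [h]
  exact (hS.inter hu.measurableSet).union (hS.compl.inter (MeasurableSet.const _))

theorem frictionExt_le (hba : ∀ z ∈ S, b z ≤ a) (x : EuclideanSpace ℝ (Fin n)) :
    frictionExt S a b x ≤ a := by
  unfold frictionExt
  split_ifs with h
  exacts [hba x h, le_rfl]

theorem lt_frictionExt_iff {lam : ℝ≥0} (hlam : (lam : ℝ≥0∞) < a)
    (x : EuclideanSpace ℝ (Fin n)) :
    (lam : ℝ≥0∞) < frictionExt S a b x ↔ x ∉ sublevelNetwork S b lam := by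
  by_cases h : x ∈ S <;> simp [frictionExt, sublevelNetwork, h, hlam]

/-- At the endpoints `deriv` sees values outside `[0,1]`, so the null set of endpoints is dropped.
-/
theorem weightedLength_congr {γ γ' : ℝ → EuclideanSpace ℝ (Fin n)}
    (h : EqOn γ γ' (Icc 0 1)) : weightedLength S a b γ = weightedLength S a b γ' := by
  unfold weightedLength
  rw [← Measure.restrict_congr_set Ioo_ae_eq_Icc]
  refine setLIntegral_congr_fun measurableSet_Ioo fun t ht => ?_
  have hev : γ =ᶠ[𝓝 t] γ' := by
    filter_upwards [Icc_mem_nhds ht.1 ht.2] with s hs using h hs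
  simp only [h (Ioo_subset_Icc_self ht), hev.deriv_eq]

theorem weightedLength_eq_lintegral_superlevel (hS : MeasurableSet S)
    (hb : LowerSemicontinuousOn b S) {γ : ℝ → EuclideanSpace ℝ (Fin n)} (hγ : Continuous γ) :
    weightedLength S a b γ = ∫⁻ l in Ioi (0 : ℝ),
      ∫⁻ t in Ioo (0 : ℝ) 1 ∩ {t | ENNReal.ofReal l < frictionExt S a b (γ t)},
        ‖deriv γ t‖ₑ := by
  unfold weightedLength
  rw [← Measure.restrict_congr_set Ioo_ae_eq_Icc]
  exact lintegral_mul_eq_lintegral_superlevel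
    ((measurable_frictionExt hS hb).comp hγ.measurable) (measurable_deriv γ).enorm _

theorem weightedLength_le_liminf_of_lipschitzWith (hS : MeasurableSet S)
    (hba : ∀ z ∈ S, b z ≤ a) (hb : LowerSemicontinuousOn b S)
    (hfin : ∀ lam : ℝ≥0, (lam : ℝ≥0∞) < a →
      (Measure.hausdorffMeasure 1 : Measure (EuclideanSpace ℝ (Fin n)))
        (sublevelNetwork S b lam) < ∞)
    {C : ℝ≥0} {γ : ℕ → ℝ → EuclideanSpace ℝ (Fin n)} {γlim : ℝ → EuclideanSpace ℝ (Fin n)}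
    (hγ : ∀ j, LipschitzWith C (γ j)) (hlimL : LipschitzWith C γlim)
    (hlim : TendstoUniformly γ γlim atTop) :
    weightedLength S a b γlim ≤ liminf (fun j => weightedLength S a b (γ j)) atTop := by
  simp_rw [weightedLength_eq_lintegral_superlevel hS hb hlimL.continuous,
    fun j => weightedLength_eq_lintegral_superlevel (a := a) hS hb (hγ j).continuous]
  refine le_trans (lintegral_mono fun l => ?_) (lintegral_liminf_le fun j => ?_)
  · rcases lt_or_ge (ENNReal.ofReal l) a with hl | hl
    · have hset : ∀ η : ℝ → EuclideanSpace ℝ (Fin n),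
          {t | ENNReal.ofReal l < frictionExt S a b (η t)} =
            η ⁻¹' (sublevelNetwork S b l.toNNReal)ᶜ := fun η => by
        ext t
        exact lt_frictionExt_iff hl (η t)
      simp_rw [hset]
      exact lintegral_enorm_deriv_compl_le_liminf hγ hlimL hlim
        (measurableSet_sublevelNetwork hS hb _) (hfin _ hl) isOpen_Ioo (by simp)
    · have hset : {t | ENNReal.ofReal l < frictionExt S a b (γlim t)} = ∅ :=
        eq_empty_of_forall_notMem fun t ht => (ht.trans_le (frictionExt_le hba _)).not_ge hl
      simp [hset]
  · refine Antitone.measurable fun l l' hll' => lintegral_mono_set ?_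
    exact inter_subset_inter_right _ fun t ht => (ENNReal.ofReal_le_ofReal hll').trans_lt ht

end Network

theorem mainTheorem3 {n : ℕ} (S : Set (EuclideanSpace ℝ (Fin n)))
    (hSC : S ⊆ hypercube n) (hSrect : CountablyOneRectifiable S) (hSmeas : MeasurableSet S)
    (a : ℝ≥0∞) (b : EuclideanSpace ℝ (Fin n) → ℝ≥0∞)
    (hba : ∀ z ∈ S, b z ≤ a) (hblsc : LowerSemicontinuousOn b S)
    (hfin : ∀ lam : ℝ≥0, (lam : ℝ≥0∞) < a →
      (Measure.hausdorffMeasure 1 : Measure (EuclideanSpace ℝ (Fin n)))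
        (sublevelNetwork S b lam) < ∞)
    (C : ℝ≥0) (γ : ℕ → ℝ → EuclideanSpace ℝ (Fin n)) (γlim : ℝ → EuclideanSpace ℝ (Fin n))
    (hγ : ∀ j, IsLipschitzPath C (γ j)) (hspeed : ∀ j, HasConstantSpeed (γ j))
    (hlim : TendstoUniformlyOn γ γlim atTop (Icc 0 1)) :
    weightedLength S a b γlim ≤ liminf (fun j => weightedLength S a b (γ j)) atTop := by
  -- Composing with the projection onto `[0,1]` makes all paths globally Lipschitz without changing
  -- their weighted length.
  set π : ℝ → ℝ := fun t => projIcc (0 : ℝ) 1 zero_le_one t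
  have hπ : ∀ t, π t ∈ Icc (0 : ℝ) 1 := fun t => (projIcc (0 : ℝ) 1 zero_le_one t).2
  have hπL : LipschitzWith 1 π := LipschitzWith.subtype_val _ |>.comp
    (LipschitzWith.projIcc zero_le_one) |>.weaken (by simp)
  have hext : ∀ η : ℝ → EuclideanSpace ℝ (Fin n), EqOn η (η ∘ π) (Icc 0 1) := fun η t ht => by
    simp [π, projIcc_of_mem zero_le_one ht]
  have hL : ∀ η : ℝ → EuclideanSpace ℝ (Fin n), LipschitzOnWith C η (Icc 0 1) →
      LipschitzWith C (η ∘ π) := fun η hη => by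
    simpa using hη.comp (hπL.lipschitzOnWith (s := univ)) fun t _ => hπ t
  have hlimL : LipschitzOnWith C γlim (Icc 0 1) := by
    refine LipschitzOnWith.of_dist_le_mul fun s hs t ht => ?_
    exact le_of_tendsto ((hlim.tendsto_at hs).dist (hlim.tendsto_at ht))
      (Eventually.of_forall fun j => (hγ j).1.dist_le_mul s hs t ht)
  rw [weightedLength_congr (hext γlim)]
  simp_rw [fun j => weightedLength_congr (S := S) (a := a) (b := b) (hext (γ j))]
  refine weightedLength_le_liminf_of_lipschitzWith hSmeas hba hblsc hfin
    (fun j => hL _ (hγ j).1) (hL _ hlimL) ?_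
  intro u hu
  filter_upwards [hlim u hu] with j hj t using hj _ (hπ t)
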